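/- **Conventions.** An *ordered family of equivalences* (o.f.e.) is a set $X$ with equivalence relations $\stackrel{n}{=}$ ($n\in\mathbb N$) such that $\stackrel{0}{=}$ is total, $\stackrel{n+1}{=}\,\subseteq\,\stackrel{n}{=}$, and $x\stackrel{n}{=}y$ for all $n$ implies $x=y$. A sequence $(a_i)$ is Cauchy if for each $k$ there is $N$ with $a_m\stackrel{k}{=}a_n$ for all $m,n\ge N$, and has limit $l$ if for each $k$ there is $N$ with $a_n\stackrel{k}{=}l$ for all $n\ge N$. A *c.o.f.e.* is an o.f.e. in which every Cauchy sequence has a limit. A map is *non-expansive* if it preserves every $\stackrel{n}{=}$; an isomorphism of c.o.f.e.'s is a bijection that is non-expansive in both directions. A *preordered c.o.f.e.* is a c.o.f.e. with a preorder $\sqsupseteq$ closed under limits: if $a_n\to a$, $b_n\to b$ and $a_n\sqsupseteq b_n$ for all $n$, then $a\sqsupseteq b$. The c.o.f.e. $\mathop{\blacktriangleright}X$ has the same elements as $X$, with $\stackrel{0}{=}$ total and $\stackrel{n+1}{=}$ on $\mathop{\blacktriangleright}X$ equal to $\stackrel{n}{=}$ on $X$. Let $\mathrm{State}$ be any set,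 and let $\mathrm{Rels}$ be the set of pairs $(\phi_{pub},\phi)$ of reflexive and transitive relations on $\mathrm{State}$ with $\phi_{pub}\subseteq\phi$. Let $\mathrm{Addr}=\mathbb N$, $\mathrm{Word}=\mathrm{Cap}+\mathbb Z$ with $\mathrm{Cap}=(\mathrm{Perm}\times\{\mathrm{global},\mathrm{local}\})\times\mathrm{Addr}\times(\mathrm{Addr}+\{\infty\})\times\mathrm{Addr}$ and $\mathrm{Perm}=\{\mathrm{o},\mathrm{ro},\mathrm{rw},\mathrm{rwl},\mathrm{rx},\mathrm{e},\mathrm{rwx},\mathrm{rwlx}\}$, and let $\mathrm{MemSegment}$ be the set of partial functions $\mathrm{Addr}\rightharpoonup\mathrm{Word}$. Let $\mathrm{UPred}(A)$ be the set of all $p\subseteq\mathbb N\times A$ such that $(n,a)\in p$ and $m\le n$ imply $(m,a)\in p$, ordered by inclusion, with $p\stackrel{n}{=}q$ iff $p$ and $q$ contain the same pairs $(k,a)$ with $k<n$. For a c.o.f.e. $X$ with two relations $\sqsupseteq^{priv}$ and $\sqsupseteq^{pub}$ put $$R(X)=\{\mathrm{revoked}\}+\{\mathrm{temp}\}\times\mathrm{State}\times\mathrm{Rels}\times\bigl(\mathrm{State}\to(X\xrightarrow[\sqsupseteq^{pub}]{mon,\,ne}\mathrm{UPred}(\mathrm{MemSegment}))\bigr)+\{\mathrm{perm}\}\times\mathrm{State}\times\mathrm{Rels}\times\bigl(\mathrm{State}\to(X\xrightarrow[\sqsupseteq^{priv}]{mon,\,ne}\mathrm{UPred}(\mathrm{MemSegment}))\bigr),$$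 where the arrows denote non-expansive maps that are monotone with respect to the indicated relation. Function spaces carry the pointwise $\stackrel{n}{=}$. For $n>0$, two elements of $R(X)$ are $\stackrel{n}{=}$ iff they lie in the same summand, have the same state and relations, and have pointwise $n$-equal functions $\mathrm{State}\to\cdots$; and two finite maps $\mathbb N\xrightharpoonup{fin}R(X)$ are $\stackrel{n}{=}$ iff they have the same domain and pointwise $n$-equal values. On $R(X)$ let $\sqsupseteq^{priv}$ be given exactly by: $(v,s',\phi_{pub},\phi,H)\sqsupseteq^{priv}(v,s,\phi_{pub},\phi,H)$ if $(s,s')\in\phi$; $r\sqsupseteq^{priv}(\mathrm{temp},s,\phi_{pub},\phi,H)$ and $r\sqsupseteq^{priv}\mathrm{revoked}$ for all $r\in R(X)$. Let $\sqsupseteq^{pub}$ be given exactly by: $(v,s',\phi_{pub},\phi,H)\sqsupseteq^{pub}(v,s,\phi_{pub},\phi,H)$ if $(s,s')\in\phi_{pub}$; $(\mathrm{temp},s,\phi_{pub},\phi,H)\sqsupseteq^{pub}\mathrm{revoked}$; $\mathrm{revoked}\sqsupseteq^{pub}\mathrm{revoked}$. On finite maps, and hence on $\mathop{\blacktriangleright}(\mathbb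 N\xrightharpoonup{fin}R(X))$, let $W'\sqsupseteq W$ mean $\mathrm{dom}(W')\supseteq\mathrm{dom}(W)$ and $W'(r)\sqsupseteq W(r)$ for all $r\in\mathrm{dom}(W)$, for $\sqsupseteq^{priv}$ and for $\sqsupseteq^{pub}$ respectively. **Theorem.** There exist a c.o.f.e. $\mathrm{Wor}$ and preorders $\sqsupseteq^{priv}$ and $\sqsupseteq^{pub}$ on it such that $(\mathrm{Wor},\sqsupseteq^{priv})$ and $(\mathrm{Wor},\sqsupseteq^{pub})$ are preordered c.o.f.e.'s, together with an isomorphism of c.o.f.e.'s $$\xi:\mathrm{Wor}\;\cong\;\mathop{\blacktriangleright}\bigl(\mathbb N\xrightharpoonup{fin}R(\mathrm{Wor})\bigr)$$ such that for all $W,W'\in\mathrm{Wor}$: $\;W'\sqsupseteq^{priv}W\iff\xi(W')\sqsupseteq^{priv}\xi(W)$, and $\;W'\sqsupseteq^{pub}W\iff\xi(W')\sqsupseteq^{pub}\xi(W)$. -/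

import Mathlib

universe u v

set_option linter.unusedVariables false

noncomputable section

namespace CapWorlds

/-! ## Complete ordered families of equivalences -/

/-- An ordered family of equivalences (o.f.e.): a set with equivalence relations `eqn n`
(written `x =ₙ y`) which get finer with `n`, the relation at `0` being total and the intersection
of all of them being equality. -/
class OFE (X : Type u) where
  eqn : ℕ → X → X → Prop
  equivalence : ∀ n, Equivalence (eqn n)
  eqn_zero : ∀ x y, eqn 0 x y
  eqn_of_succ : ∀ n x y, eqn (n + 1) x y → eqn n x y
  eq_of_eqn : ∀ x y, (∀ n, eqn n x y) → x = y

open OFE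

/-- Cauchy sequences in an o.f.e. -/
def IsCauchy {X : Type u} [OFE X] (a : ℕ → X) : Prop :=
  ∀ k, ∃ N, ∀ m ≥ N, ∀ n ≥ N, eqn k (a m) (a n)

/-- `l` is the limit of the sequence `a` in an o.f.e. -/
def IsLimit {X : Type u} [OFE X] (a : ℕ → X) (l : X) : Prop :=
  ∀ k, ∃ N, ∀ n ≥ N, eqn k (a n) l

/-- A complete ordered family of equivalences (c.o.f.e.): every Cauchy sequence has a limit. -/
class COFE (X : Type u) extends OFE X where
  complete : ∀ a : ℕ → X, IsCauchy a → ∃ l, IsLimit a l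

/-- `(X, ge)` is a preordered c.o.f.e.: `ge` is a preorder on the c.o.f.e. `X` which is closed under
limits of (convergent) sequences. -/
structure IsPreorderedCOFE (X : Type u) [COFE X] (ge : X → X → Prop) : Prop where
  refl : ∀ x, ge x x
  trans : ∀ x y z, ge x y → ge y z → ge x z
  limit : ∀ (a b : ℕ → X) (l m : X), IsLimit a l → IsLimit b m →
    (∀ n, ge (a n) (b n)) → ge l m

/-- Non-expansive maps between o.f.e.s. -/
def NonExpansive {X : Type u} {Y : Type v} [OFE X] [OFE Y] (f : X → Y) : Prop :=
  ∀ n x y, eqn n x y → eqn n (f x) (f y)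

/-- Isomorphisms of c.o.f.e.s: bijections that are non-expansive in both directions. -/
structure COFEIso (X : Type u) (Y : Type v) [COFE X] [COFE Y] extends X ≃ Y where
  nonExpansive_toFun : NonExpansive toFun
  nonExpansive_invFun : NonExpansive invFun

section Lemmas

variable {X : Type u} [OFE X]

theorem eqn_refl (n : ℕ) (x : X) : eqn n x x := (equivalence n).refl x

theorem eqn_symm {n : ℕ} {x y : X} (h : eqn n x y) : eqn n y x := (equivalence n).symm h

theorem eqn_trans {n : ℕ} {x y z : X} (h : eqn n x y) (h' : eqn n y z) : eqn n x z :=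
  (equivalence n).trans h h'

theorem eqn_of_le {m n : ℕ} (hmn : m ≤ n) {x y : X} (h : eqn n x y) : eqn m x y := by
  induction n, hmn using Nat.le_induction with
  | base => exact h
  | succ k _ ih => exact ih (eqn_of_succ _ _ _ h)

theorem IsLimit.eqn_of_forall {a : ℕ → X} {l : X} (hl : IsLimit a l) {k N : ℕ}
    (h : ∀ m ≥ N, ∀ n ≥ N, eqn k (a m) (a n)) : ∀ n ≥ N, eqn k (a n) l := by
  intro n hn
  obtain ⟨M, hM⟩ := hl k
  exact eqn_trans (h n hn (max M N) (le_max_right _ _)) (hM _ (le_max_left _ _))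

/-- To prove completeness it is enough to find limits of Cauchy sequences whose terms are all
equal at level `1`. -/
theorem complete_of_eqn_one
    (h : ∀ a : ℕ → X, IsCauchy a → (∀ n, eqn 1 (a 0) (a n)) → ∃ l, IsLimit a l)
    (a : ℕ → X) (ha : IsCauchy a) : ∃ l, IsLimit a l := by
  obtain ⟨N, hN⟩ := ha 1
  obtain ⟨l, hl⟩ := h (fun i => a (N + i)) (fun k => by
      obtain ⟨M, hM⟩ := ha k
      exact ⟨M, fun m hm n hn => hM _ (by omega) _ (by omega)⟩)
    (fun n => hN _ (by omega) _ (by omega))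
  refine ⟨l, fun k => ?_⟩
  obtain ⟨M, hM⟩ := hl k
  refine ⟨N + M, fun n hn => ?_⟩
  have := hM (n - N) (by omega)
  simp only at this
  rwa [show N + (n - N) = n by omega] at this

end Lemmas

/-! ## The later functor -/

/-- The later functor `▶`: the same underlying set, with the equivalences shifted by one. -/
@[ext] structure Later (X : Type u) where
  next ::
  val : X

instance {X : Type u} [OFE X] : OFE (Later X) where
  eqn
    | 0, _, _ => True
    | n + 1, x, y => eqn n x.val y.val
  equivalence
    | 0 => ⟨fun _ => trivial, fun _ => trivial, fun _ _ => trivial⟩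
    | n + 1 => ⟨fun _ => eqn_refl _ _, fun h => eqn_symm h, fun h h' => eqn_trans h h'⟩
  eqn_zero _ _ := trivial
  eqn_of_succ
    | 0, _, _, _ => trivial
    | _ + 1, _, _, h => eqn_of_succ _ _ _ h
  eq_of_eqn x y h := Later.ext (eq_of_eqn _ _ fun n => h (n + 1))

instance {X : Type u} [COFE X] : COFE (Later X) where
  complete a ha := by
    obtain ⟨l, hl⟩ := COFE.complete (fun i => (a i).val) (fun k => ha (k + 1))
    exact ⟨⟨l⟩, fun
      | 0 => ⟨0, fun _ _ => trivial⟩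
      | k + 1 => hl k⟩

/-! ## Uniform predicates -/

/-- Uniform predicates on `A`: sets of pairs of a step index and an element of `A` which are
downwards closed in the step index. -/
@[ext] structure UPred (A : Type u) where
  carrier : Set (ℕ × A)
  down_closed : ∀ n m a, (n, a) ∈ carrier → m ≤ n → (m, a) ∈ carrier

/-- `p =ₙ q` if `p` and `q` agree on all step indices below `n`. -/
instance {A : Type u} : OFE (UPred A) where
  eqn n p q := ∀ k < n, ∀ a, (k, a) ∈ p.carrier ↔ (k, a) ∈ q.carrier
  equivalence n :=
    ⟨fun _ _ _ _ => Iff.rfl, fun h k hk a => (h k hk a).symm,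
      fun h h' k hk a => (h k hk a).trans (h' k hk a)⟩
  eqn_zero _ _ k hk := absurd hk (Nat.not_lt_zero k)
  eqn_of_succ _ _ _ h k hk := h k (Nat.lt_succ_of_lt hk)
  eq_of_eqn p q h := UPred.ext (Set.ext fun ⟨k, a⟩ => h (k + 1) k (Nat.lt_succ_self k) a)

instance {A : Type u} : COFE (UPred A) where
  complete a ha := by
    choose N hN using ha
    refine ⟨⟨{x | x ∈ (a (N (x.1 + 1))).carrier}, ?_⟩, fun k => ⟨N k, fun n hn j hj x => ?_⟩⟩
    · intro n m x hx hmn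
      have h1 := (hN (n + 1) (N (n + 1)) le_rfl (max (N (n + 1)) (N (m + 1))) (le_max_left _ _)
        m (by omega) x).1 ((a (N (n + 1))).down_closed n m x hx hmn)
      exact (hN (m + 1) (N (m + 1)) le_rfl (max (N (n + 1)) (N (m + 1))) (le_max_right _ _)
        m (by omega) x).2 h1
    · have h1 := hN k n hn (max (N k) (N (j + 1))) (le_max_left _ _) j hj x
      have h2 := hN (j + 1) (N (j + 1)) le_rfl (max (N k) (N (j + 1))) (le_max_right _ _)
        j (by omega) x
      exact h1.trans h2.symm

/-- The monotone and non-expansive maps from an o.f.e. `X` with a relation `ge` to the uniform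
predicates on `A` (ordered by inclusion). Here `ge x' x` is read as `x'` being above `x`. -/
@[ext] structure MonNE (X : Type u) [OFE X] (ge : X → X → Prop) (A : Type v) where
  toFun : X → UPred A
  monotone : ∀ x' x, ge x' x → (toFun x).carrier ⊆ (toFun x').carrier
  nonExpansive : NonExpansive toFun

/-- Pointwise equivalences. -/
instance {X : Type u} [OFE X] {ge : X → X → Prop} {A : Type v} : OFE (MonNE X ge A) where
  eqn n f g := ∀ x, eqn n (f.toFun x) (g.toFun x)
  equivalence n :=
    ⟨fun _ _ => eqn_refl _ _, fun h x => eqn_symm (h x), fun h h' x => eqn_trans (h x) (h' x)⟩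
  eqn_zero _ _ _ := eqn_zero _ _
  eqn_of_succ _ _ _ h x := eqn_of_succ _ _ _ (h x)
  eq_of_eqn f g h := MonNE.ext (funext fun x => eq_of_eqn _ _ fun n => h n x)

instance {X : Type u} [OFE X] {ge : X → X → Prop} {A : Type v} : COFE (MonNE X ge A) where
  complete a ha := by
    have hx : ∀ x, ∃ l, IsLimit (fun i => (a i).toFun x) l := fun x =>
      COFE.complete _ fun k => by
        obtain ⟨N, hN⟩ := ha k
        exact ⟨N, fun m hm n hn => hN m hm n hn x⟩
    choose g hg using hx
    have hgk : ∀ k, ∃ N, ∀ n ≥ N, ∀ x, eqn k ((a n).toFun x) (g x) := fun k => by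
      obtain ⟨N, hN⟩ := ha k
      exact ⟨N, fun n hn x => (hg x).eqn_of_forall (fun m hm n hn => hN m hm n hn x) n hn⟩
    refine ⟨⟨g, ?_, ?_⟩, hgk⟩
    · rintro x' x hxx ⟨k, y⟩ hy
      obtain ⟨N, hN⟩ := hgk (k + 1)
      exact (hN N le_rfl x' k (Nat.lt_succ_self k) y).1 ((a N).monotone x' x hxx
        ((hN N le_rfl x k (Nat.lt_succ_self k) y).2 hy))
    · intro k x y hxy
      obtain ⟨N, hN⟩ := hgk k
      exact eqn_trans (eqn_symm (hN N le_rfl x))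
        (eqn_trans ((a N).nonExpansive k x y hxy) (hN N le_rfl y))

/-! ## Finite maps -/

/-- Finite partial maps `ℕ ⇀ X`. At positive levels, two of them are equal if they have the same
domain and their values are equal pointwise. -/
instance {X : Type u} [OFE X] : OFE (Finmap fun _ : ℕ => X) where
  eqn n f g := n = 0 ∨ (f.keys = g.keys ∧
    ∀ r x y, f.lookup r = some x → g.lookup r = some y → eqn n x y)
  equivalence n := by
    refine ⟨fun f => Or.inr ⟨rfl, fun r x y hx hy => ?_⟩, fun {f g} h => ?_, fun {f g k} h h' => ?_⟩
    · rw [hx] at hy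
      cases hy
      exact eqn_refl _ _
    · exact h.imp id fun h => ⟨h.1.symm, fun r x y hx hy => eqn_symm (h.2 r y x hy hx)⟩
    · rcases h with h | h
      · exact Or.inl h
      rcases h' with h' | h'
      · exact Or.inl h'
      refine Or.inr ⟨h.1.trans h'.1, fun r x z hx hz => ?_⟩
      have hr : r ∈ g.keys := by
        rw [← h.1, Finmap.mem_keys]
        exact Finmap.mem_of_lookup_eq_some hx
      obtain ⟨y, hy⟩ := Finmap.mem_iff.1 (Finmap.mem_keys.1 hr)
      exact eqn_trans (h.2 r x y hx hy) (h'.2 r y z hy hz)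
  eqn_zero _ _ := Or.inl rfl
  eqn_of_succ n f g h := by
    rcases h with h | h
    · exact absurd h (Nat.succ_ne_zero n)
    · exact Or.inr ⟨h.1, fun r x y hx hy => eqn_of_succ _ _ _ (h.2 r x y hx hy)⟩
  eq_of_eqn f g h := by
    have hk : f.keys = g.keys := ((h 1).resolve_left one_ne_zero).1
    refine Finmap.ext_lookup fun r => ?_
    cases hx : f.lookup r with
    | none =>
      rw [Finmap.lookup_eq_none, ← Finmap.mem_keys, hk, Finmap.mem_keys] at hx
      exact (Finmap.lookup_eq_none.2 hx).symm
    | some x =>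
      have hr : r ∈ g.keys := by
        rw [← hk, Finmap.mem_keys]
        exact Finmap.mem_of_lookup_eq_some hx
      obtain ⟨y, hy⟩ := Finmap.mem_iff.1 (Finmap.mem_keys.1 hr)
      rw [hy, eq_of_eqn x y fun n => ?_]
      rcases h n with h0 | h0
      · rw [h0]
        exact eqn_zero _ _
      · exact h0.2 r x y hx hy

instance {X : Type u} [COFE X] : COFE (Finmap fun _ : ℕ => X) where
  complete := complete_of_eqn_one fun a ha h1 => by
    classical
    have hk : ∀ n, (a 0).keys = (a n).keys := fun n => ((h1 n).resolve_left one_ne_zero).1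
    have hl : ∀ r n, r ∈ (a 0).keys → ∃ x, (a n).lookup r = some x := fun r n hr => by
      rw [hk n, Finmap.mem_keys] at hr
      exact Finmap.mem_iff.1 hr
    have hr : ∀ r, ∃ l : Option X, (l.isSome ↔ r ∈ (a 0).keys) ∧ ∀ y, l = some y → ∀ k N,
        (∀ m ≥ N, ∀ n ≥ N, eqn k (a m) (a n)) → ∀ n ≥ N, ∀ x, (a n).lookup r = some x →
          eqn k x y := fun r => by
      by_cases hr : r ∈ (a 0).keys
      · choose b hb using fun n => hl r n hr
        have key : ∀ k N, (∀ m ≥ N, ∀ n ≥ N, eqn k (a m) (a n)) →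
            ∀ m ≥ N, ∀ n ≥ N, eqn k (b m) (b n) := fun k N h m hm n hn => by
          rcases h m hm n hn with h0 | h0
          · rw [h0]
            exact eqn_zero _ _
          · exact h0.2 r _ _ (hb m) (hb n)
        obtain ⟨l, hl⟩ := COFE.complete b fun k => by
          obtain ⟨N, hN⟩ := ha k
          exact ⟨N, key k N hN⟩
        refine ⟨some l, by simp [hr], fun y hy k N h n hn x hx => ?_⟩
        cases hy
        rw [hb n] at hx
        cases hx
        exact hl.eqn_of_forall (key k N h) n hn
      · exact ⟨none, by simp [hr], by simp⟩
    choose l hl1 hl2 using hr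
    refine ⟨Finmap.keysLookupEquiv.symm ⟨((a 0).keys, l), hl1⟩, fun k => ?_⟩
    obtain ⟨N, hN⟩ := ha k
    refine ⟨N, fun n hn => Or.inr ⟨?_, fun r x y hx hy => ?_⟩⟩
    · exact (hk n).symm.trans
        (congrArg Prod.fst (congrArg Subtype.val
          (Finmap.keysLookupEquiv.apply_symm_apply ⟨((a 0).keys, l), hl1⟩))).symm
    · rw [Finmap.keysLookupEquiv_symm_apply_lookup] at hy
      exact hl2 r y hy k N hN n hn x hx

/-! ## Memory segments of the capability machine -/

abbrev Addr : Type := ℕ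

inductive Perm : Type
  | o | ro | rw | rwl | rx | e | rwx | rwlx

inductive Locality : Type
  | glob | loc

/-- A capability: permission and locality, base address, end address (possibly `∞`), and current
address. -/
abbrev Cap : Type := (Perm × Locality) × Addr × WithTop Addr × Addr

abbrev Word : Type := Cap ⊕ ℤ

/-- Memory segments are partial functions from addresses to words. -/
abbrev MemSegment : Type := Addr →. Word

/-! ## Regions and future worlds -/

/-- Pairs of a public and a (private) transition relation on states, both reflexive and transitive,
the public one being contained in the other one. -/
structure Rels (State : Type u) where
  pub : State → State → Prop
  priv : State → State → Prop
  pub_refl : ∀ s, pub s s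
  pub_trans : ∀ s t w, pub s t → pub t w → pub s w
  priv_refl : ∀ s, priv s s
  priv_trans : ∀ s t w, priv s t → priv t w → priv s w
  pub_le_priv : ∀ s t, pub s t → priv s t

/-- The sum `{revoked} + {temp} × State × Rels × (State → (X → UPred MemSegment)) +
{perm} × State × Rels × (State → (X → UPred MemSegment))`, where the functions of temporary
regions are monotone for `gePub` and those of permanent regions are monotone for `gePriv`, and all
are non-expansive. -/
inductive Region (State : Type u) (X : Type u) [OFE X] (gePriv gePub : X → X → Prop) : Type u
  | revoked
  | temp (s : State) (φ : Rels State) (H : State → MonNE X gePub MemSegment)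
  | perm (s : State) (φ : Rels State) (H : State → MonNE X gePriv MemSegment)

section Region

variable {State X : Type u} [OFE X] {gePriv gePub : X → X → Prop}

/-- The `n`-equality of regions at positive `n`: it is that of a sum of products, the sets of
views, states and transition relations being discrete. -/
inductive Region.EqnPos (n : ℕ) :
    Region State X gePriv gePub → Region State X gePriv gePub → Prop
  | revoked : EqnPos n .revoked .revoked
  | temp (s : State) (φ : Rels State) (H H' : State → MonNE X gePub MemSegment)
      (h : ∀ t, eqn n (H t) (H' t)) : EqnPos n (.temp s φ H) (.temp s φ H')
  | perm (s : State) (φ : Rels State) (H H' : State → MonNE X gePriv MemSegment)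
      (h : ∀ t, eqn n (H t) (H' t)) : EqnPos n (.perm s φ H) (.perm s φ H')

instance : OFE (Region State X gePriv gePub) where
  eqn n ρ ρ' := n = 0 ∨ Region.EqnPos n ρ ρ'
  equivalence n := by
    refine ⟨fun ρ => Or.inr ?_, fun {ρ ρ'} h => h.imp id fun h => ?_, fun {ρ ρ' ρ''} h h' => ?_⟩
    · cases ρ
      · exact .revoked
      · exact .temp _ _ _ _ fun _ => eqn_refl _ _
      · exact .perm _ _ _ _ fun _ => eqn_refl _ _
    · cases h with
      | revoked => exact .revoked
      | temp s φ H H' hH => exact .temp _ _ _ _ fun t => eqn_symm (hH t)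
      | perm s φ H H' hH => exact .perm _ _ _ _ fun t => eqn_symm (hH t)
    · rcases h with h | h
      · exact Or.inl h
      rcases h' with h' | h'
      · exact Or.inl h'
      refine Or.inr ?_
      cases h with
      | revoked => exact h'
      | temp s φ H H' h =>
        cases h' with
        | temp _ _ _ _ h' => exact .temp _ _ _ _ fun t => eqn_trans (h t) (h' t)
      | perm s φ H H' h =>
        cases h' with
        | perm _ _ _ _ h' => exact .perm _ _ _ _ fun t => eqn_trans (h t) (h' t)
  eqn_zero _ _ := Or.inl rfl
  eqn_of_succ n ρ ρ' h := by
    rcases h with h | h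
    · exact absurd h (Nat.succ_ne_zero n)
    refine Or.inr ?_
    cases h with
    | revoked => exact .revoked
    | temp s φ H H' h => exact .temp _ _ _ _ fun t => eqn_of_succ _ _ _ (h t)
    | perm s φ H H' h => exact .perm _ _ _ _ fun t => eqn_of_succ _ _ _ (h t)
  eq_of_eqn ρ ρ' h := by
    have h' : ∀ n, Region.EqnPos (n + 1) ρ ρ' := fun n =>
      (h (n + 1)).resolve_left (Nat.succ_ne_zero n)
    cases h' 0 with
    | revoked => rfl
    | temp s φ H H' _ =>
      congr 1
      refine funext fun t => eq_of_eqn _ _ fun n => eqn_of_succ _ _ _ ?_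
      cases h' n with
      | temp _ _ _ _ h => exact h t
    | perm s φ H H' _ =>
      congr 1
      refine funext fun t => eq_of_eqn _ _ fun n => eqn_of_succ _ _ _ ?_
      cases h' n with
      | perm _ _ _ _ h => exact h t

instance : COFE (Region State X gePriv gePub) where
  complete := complete_of_eqn_one fun a ha h1 => by
    have h1' : ∀ n, Region.EqnPos 1 (a 0) (a n) := fun n => (h1 n).resolve_left one_ne_zero
    rcases h0 : a 0 with _ | ⟨s, φ, H0⟩ | ⟨s, φ, H0⟩
    · refine ⟨.revoked, fun k => ⟨0, fun n _ => Or.inr ?_⟩⟩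
      have hn := h1' n
      rw [h0] at hn
      generalize a n = ρ at hn
      cases hn
      exact .revoked
    · have hH : ∀ n, ∃ H, a n = .temp s φ H := fun n => by
        have hn := h1' n
        rw [h0] at hn
        generalize a n = ρ at hn
        cases hn
        exact ⟨_, rfl⟩
      choose H hH using hH
      have key : ∀ k, ∃ N, ∀ m ≥ N, ∀ n ≥ N, ∀ t, eqn k (H m t) (H n t) := fun k => by
        obtain ⟨N, hN⟩ := ha k
        refine ⟨N, fun m hm n hn t => ?_⟩
        have h := hN m hm n hn
        rw [hH m, hH n] at h
        rcases h with h | h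
        · rw [h]
          exact eqn_zero _ _
        · cases h with
          | temp _ _ _ _ h => exact h t
      have hl : ∀ t, ∃ l, IsLimit (fun n => H n t) l := fun t => COFE.complete _ fun k => by
        obtain ⟨N, hN⟩ := key k
        exact ⟨N, fun m hm n hn => hN m hm n hn t⟩
      choose L hL using hl
      refine ⟨.temp s φ L, fun k => ?_⟩
      obtain ⟨N, hN⟩ := key k
      refine ⟨N, fun n hn => Or.inr ?_⟩
      rw [hH n]
      exact .temp _ _ _ _ fun t =>
        (hL t).eqn_of_forall (fun m hm n hn => hN m hm n hn t) n hn
    · have hH : ∀ n, ∃ H, a n = .perm s φ H := fun n => by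
        have hn := h1' n
        rw [h0] at hn
        generalize a n = ρ at hn
        cases hn
        exact ⟨_, rfl⟩
      choose H hH using hH
      have key : ∀ k, ∃ N, ∀ m ≥ N, ∀ n ≥ N, ∀ t, eqn k (H m t) (H n t) := fun k => by
        obtain ⟨N, hN⟩ := ha k
        refine ⟨N, fun m hm n hn t => ?_⟩
        have h := hN m hm n hn
        rw [hH m, hH n] at h
        rcases h with h | h
        · rw [h]
          exact eqn_zero _ _
        · cases h with
          | perm _ _ _ _ h => exact h t
      have hl : ∀ t, ∃ l, IsLimit (fun n => H n t) l := fun t => COFE.complete _ fun k => by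
        obtain ⟨N, hN⟩ := key k
        exact ⟨N, fun m hm n hn => hN m hm n hn t⟩
      choose L hL using hl
      refine ⟨.perm s φ L, fun k => ?_⟩
      obtain ⟨N, hN⟩ := key k
      refine ⟨N, fun n hn => Or.inr ?_⟩
      rw [hH n]
      exact .perm _ _ _ _ fun t =>
        (hL t).eqn_of_forall (fun m hm n hn => hN m hm n hn t) n hn

/-- `Region.PrivFuture ρ' ρ`: the region `ρ'` is a private future region of `ρ`. -/
inductive Region.PrivFuture :
    Region State X gePriv gePub → Region State X gePriv gePub → Prop
  | temp_step (s s' : State) (φ : Rels State) (H : State → MonNE X gePub MemSegment)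
      (h : φ.priv s s') : PrivFuture (.temp s' φ H) (.temp s φ H)
  | perm_step (s s' : State) (φ : Rels State) (H : State → MonNE X gePriv MemSegment)
      (h : φ.priv s s') : PrivFuture (.perm s' φ H) (.perm s φ H)
  | of_temp (ρ : Region State X gePriv gePub) (s : State) (φ : Rels State)
      (H : State → MonNE X gePub MemSegment) : PrivFuture ρ (.temp s φ H)
  | of_revoked (ρ : Region State X gePriv gePub) : PrivFuture ρ .revoked

/-- `Region.PubFuture ρ' ρ`: the region `ρ'` is a public future region of `ρ`. -/
inductive Region.PubFuture :
    Region State X gePriv gePub → Region State X gePriv gePub → Prop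
  | temp_step (s s' : State) (φ : Rels State) (H : State → MonNE X gePub MemSegment)
      (h : φ.pub s s') : PubFuture (.temp s' φ H) (.temp s φ H)
  | perm_step (s s' : State) (φ : Rels State) (H : State → MonNE X gePriv MemSegment)
      (h : φ.pub s s') : PubFuture (.perm s' φ H) (.perm s φ H)
  | temp_revoked (s : State) (φ : Rels State) (H : State → MonNE X gePub MemSegment) :
      PubFuture (.temp s φ H) .revoked
  | revoked_revoked : PubFuture .revoked .revoked

end Region

/-- Finite maps from region names (natural numbers) to regions. -/
abbrev RegionMap (State : Type u) (X : Type u) [OFE X] (gePriv gePub : X → X → Prop) : Type u :=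
  Finmap fun _ : ℕ => Region State X gePriv gePub

section RegionMap

variable {State X : Type u} [OFE X] {gePriv gePub : X → X → Prop}

/-- `W'` is a private future world of `W`: its domain is larger and all regions of `W` have moved
to private future regions. -/
def RegionMap.PrivFuture (W' W : RegionMap State X gePriv gePub) : Prop :=
  W.keys ⊆ W'.keys ∧ ∀ r ρ' ρ, W'.lookup r = some ρ' → W.lookup r = some ρ →
    Region.PrivFuture ρ' ρ

/-- `W'` is a public future world of `W`: its domain is larger and all regions of `W` have moved
to public future regions. -/
def RegionMap.PubFuture (W' W : RegionMap State X gePriv gePub) : Prop :=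
  W.keys ⊆ W'.keys ∧ ∀ r ρ' ρ, W'.lookup r = some ρ' → W.lookup r = some ρ →
    Region.PubFuture ρ' ρ

end RegionMap

end CapWorlds

end

open CapWorlds

noncomputable section

namespace CapWorlds

open OFE

/-! ## Limits -/

section Limits

variable {X : Type u} {Y : Type v} [OFE X] [OFE Y]

/-! The worlds form a fixed point, up to isomorphism, of the operation sending `A` to the later of
finite maps into regions over `A`. This operation is a contravariant functor on c.o.f.e.'s with two
limit-closed preorders. Morphisms are the non-expansive maps monotone for both preorders, since
precomposition must respect public monotonicity in temporary regions and private monotonicity in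
permanent ones. The functor is locally contractive because of `▶`: `n`-equal morphisms have
`(n+1)`-equal images.

Starting from the one-point object, the functor is iterated. Contravariance forces maps between
iterates in both directions. The natural point (the empty region map) starts them, and
contractiveness makes the round trip from any iterate through stage `j` agree with the identity up
to level `j` (`eqn_trans_trans`). The inverse limit is therefore approximated to level `k` by its
`k`-th stage (`eqn_embed_proj`). Applying the functor to the embeddings gives `fold`; applying it to
the projections and passing to the limit gives the inverse `unfold`.

Both maps are morphisms, so the isomorphism preserves and reflects the two preorders. Monotonicity
of `unfold` needs the preorders on region maps to be limit-closed (`PrivFuture.of_approx`,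
`PubFuture.of_approx`). This holds because states and transition relations are discrete, while
related regions that both carry functions carry the same one, apart from the cases where everything
is allowed. -/

theorem IsLimit.unique {a : ℕ → X} {l m : X} (hl : IsLimit a l) (hm : IsLimit a m) : l = m := by
  refine eq_of_eqn _ _ fun k => ?_
  obtain ⟨N, hN⟩ := hl k
  obtain ⟨M, hM⟩ := hm k
  exact eqn_trans (eqn_symm (hN (max N M) (le_max_left _ _))) (hM _ (le_max_right _ _))

theorem IsLimit.map {a : ℕ → X} {l : X} (hl : IsLimit a l) {f : X → Y} (hf : NonExpansive f) :
    IsLimit (fun i => f (a i)) (f l) := fun k => by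
  obtain ⟨N, hN⟩ := hl k
  exact ⟨N, fun n hn => hf k _ _ (hN n hn)⟩

theorem isLimit_of_eqn_self {a : ℕ → X} {l : X} (h : ∀ k, eqn k (a k) l) : IsLimit a l :=
  fun k => ⟨k, fun n hn => eqn_of_le hn (h n)⟩

theorem isLimit_const_of_le {a : ℕ → X} {l : X} (N : ℕ) (h : ∀ n ≥ N, a n = l) : IsLimit a l :=
  fun k => ⟨N, fun n hn => by rw [h n hn]; exact eqn_refl _ _⟩

/-- Preorders given by finite maps with pointwise related values are closed under limits if the
preorder on the values is. -/
theorem isPreorderedCOFE_later_finmap {X : Type u} [COFE X] {ge : X → X → Prop}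
    (hrefl : ∀ x, ge x x) (htrans : ∀ x y z, ge x y → ge y z → ge x z)
    (hlim : ∀ x y, (∀ k, ∃ x' y', ge x' y' ∧ eqn k x' x ∧ eqn k y' y) → ge x y) :
    IsPreorderedCOFE (Later (Finmap fun _ : ℕ => X)) fun a b =>
      b.val.keys ⊆ a.val.keys ∧
        ∀ r x y, a.val.lookup r = some x → b.val.lookup r = some y → ge x y where
  refl a := ⟨subset_rfl, fun r x y hx hy => by
    rw [hx] at hy
    cases hy
    exact hrefl x⟩
  trans a b c hab hbc := ⟨hbc.1.trans hab.1, fun r x z hx hz => by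
    have hr := hbc.1 (Finmap.mem_keys.2 (Finmap.mem_of_lookup_eq_some hz))
    obtain ⟨y, hy⟩ := Finmap.mem_iff.1 (Finmap.mem_keys.1 hr)
    exact htrans _ _ _ (hab.2 r x y hx hy) (hbc.2 r y z hy hz)⟩
  limit a b l m hl hm hab := by
    -- Of the two extra levels in `k + 2`, one is consumed by `▶`; the other keeps the remaining
    -- level positive, so that the domains agree.
    have key : ∀ k, ∃ n, ((a n).val.keys = l.val.keys ∧ ∀ r x y, (a n).val.lookup r = some x →
          l.val.lookup r = some y → eqn (k + 1) x y) ∧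
        ((b n).val.keys = m.val.keys ∧ ∀ r x y, (b n).val.lookup r = some x →
          m.val.lookup r = some y → eqn (k + 1) x y) := fun k => by
      obtain ⟨N, hN⟩ := hl (k + 2)
      obtain ⟨M, hM⟩ := hm (k + 2)
      exact ⟨max N M, (hN _ (le_max_left _ _)).resolve_left k.succ_ne_zero,
        (hM _ (le_max_right _ _)).resolve_left k.succ_ne_zero⟩
    have some_of_keys : ∀ {f g : Finmap fun _ : ℕ => X} {r x}, f.keys = g.keys →
        g.lookup r = some x → ∃ y, f.lookup r = some y := fun h hx =>
      Finmap.mem_iff.1 (Finmap.mem_keys.1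
        (h ▸ Finmap.mem_keys.2 (Finmap.mem_of_lookup_eq_some hx)))
    refine ⟨?_, fun r x y hx hy => hlim _ _ fun k => ?_⟩
    · obtain ⟨n, ha, hb⟩ := key 0
      rw [← ha.1, ← hb.1]
      exact (hab n).1
    · obtain ⟨n, ha, hb⟩ := key k
      obtain ⟨x', hx'⟩ := some_of_keys ha.1 hx
      obtain ⟨y', hy'⟩ := some_of_keys hb.1 hy
      exact ⟨x', y', (hab n).2 r x' y' hx' hy', eqn_of_succ _ _ _ (ha.2 r x' x hx' hx),
        eqn_of_succ _ _ _ (hb.2 r y' y hy' hy)⟩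

end Limits

/-! ## Contravariant functors on c.o.f.e.s with two preorders -/

/-- C.o.f.e.s with two preorders, each closed under limits. -/
structure BiPreCOFE where
  carrier : Type u
  [cofe : COFE carrier]
  gePriv : carrier → carrier → Prop
  gePub : carrier → carrier → Prop
  isPriv : IsPreorderedCOFE carrier gePriv
  isPub : IsPreorderedCOFE carrier gePub

instance : CoeSort BiPreCOFE.{u} (Type u) := ⟨BiPreCOFE.carrier⟩

instance (A : BiPreCOFE.{u}) : COFE A := A.cofe

/-- Non-expansive maps that are monotone for both preorders. -/
structure BiPreCOFE.Hom (A B : BiPreCOFE.{u}) where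
  toFun : A → B
  nonExpansive : NonExpansive toFun
  mono_priv : ∀ x' x, A.gePriv x' x → B.gePriv (toFun x') (toFun x)
  mono_pub : ∀ x' x, A.gePub x' x → B.gePub (toFun x') (toFun x)

instance (A B : BiPreCOFE.{u}) : CoeFun (A.Hom B) fun _ => A → B := ⟨BiPreCOFE.Hom.toFun⟩

namespace BiPreCOFE

/-- The identity morphism. -/
def Hom.id (A : BiPreCOFE.{u}) : A.Hom A where
  toFun x := x
  nonExpansive _ _ _ h := h
  mono_priv _ _ h := h
  mono_pub _ _ h := h

/-- Composition of morphisms. -/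
def Hom.comp {A B C : BiPreCOFE.{u}} (g : B.Hom C) (f : A.Hom B) : A.Hom C where
  toFun x := g (f x)
  nonExpansive n x y h := g.nonExpansive _ _ _ (f.nonExpansive n x y h)
  mono_priv x y h := g.mono_priv _ _ (f.mono_priv x y h)
  mono_pub x y h := g.mono_pub _ _ (f.mono_pub x y h)

/-- The constant morphism. -/
def Hom.const {A B : BiPreCOFE.{u}} (b : B) : A.Hom B where
  toFun _ := b
  nonExpansive _ _ _ _ := eqn_refl _ _
  mono_priv _ _ _ := B.isPriv.refl b
  mono_pub _ _ _ := B.isPub.refl b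

instance : COFE PUnit.{u + 1} where
  eqn _ _ _ := True
  equivalence _ := ⟨fun _ => trivial, fun _ => trivial, fun _ _ => trivial⟩
  eqn_zero _ _ := trivial
  eqn_of_succ _ _ _ _ := trivial
  eq_of_eqn _ _ _ := rfl
  complete _ _ := ⟨⟨⟩, fun _ => ⟨0, fun _ _ => trivial⟩⟩

/-- The terminal object. -/
def unit : BiPreCOFE.{u} where
  carrier := PUnit
  gePriv _ _ := True
  gePub _ _ := True
  isPriv := ⟨fun _ => trivial, fun _ _ _ _ _ => trivial, fun _ _ _ _ _ _ _ => trivial⟩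
  isPub := ⟨fun _ => trivial, fun _ _ _ _ _ => trivial, fun _ _ _ _ _ _ _ => trivial⟩

/-- A locally contractive contravariant functor with a natural point. -/
structure ContraFunctor where
  obj : BiPreCOFE.{u} → BiPreCOFE.{u}
  map : ∀ {A B : BiPreCOFE.{u}}, A.Hom B → (obj B).Hom (obj A)
  pt : ∀ A, obj A
  map_pt : ∀ {A B : BiPreCOFE.{u}} (f : A.Hom B), map f (pt B) = pt A
  map_comp : ∀ {A B C : BiPreCOFE.{u}} (f : A.Hom B) (g : B.Hom C) x,
    map f (map g x) = map (g.comp f) x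
  map_id : ∀ {A : BiPreCOFE.{u}} (f : A.Hom A), (∀ a, f a = a) → ∀ x, map f x = x
  contractive : ∀ {A B : BiPreCOFE.{u}} (n : ℕ) (f g : A.Hom B),
    (∀ a, eqn n (f a) (g a)) → ∀ x, eqn (n + 1) (map f x) (map g x)

/-! ### Fixed points of locally contractive contravariant functors. -/

namespace ContraFunctor

variable (F : ContraFunctor.{u})

theorem map_congr {A B : BiPreCOFE.{u}} {f g : A.Hom B} (h : ∀ a, f a = g a) (x : F.obj B) :
    F.map f x = F.map g x :=
  eq_of_eqn _ _ fun n => eqn_of_succ _ _ _ <| F.contractive n f g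
    (fun a => by rw [h]; exact eqn_refl _ _) x

/-- Compare `f` with the identity by contractiveness. The gained level is what makes errors vanish
along the iteration. -/
theorem eqn_map_self {A : BiPreCOFE.{u}} {n : ℕ} {f : A.Hom A} (h : ∀ a, eqn n (f a) a)
    (x : F.obj A) : eqn (n + 1) (F.map f x) x := by
  have h' := F.contractive n f (Hom.id A) h x
  rwa [F.map_id (Hom.id A) fun _ => rfl] at h'

/-- The iterates of the functor, starting from the terminal object. -/
def iter : ℕ → BiPreCOFE.{u}
  | 0 => unit
  | n + 1 => F.obj (iter n)

/-- The transition morphisms between the iterates, in both directions. -/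
def trans : ∀ k j, (F.iter k).Hom (F.iter j)
  | _, 0 => Hom.const (B := unit) PUnit.unit
  | 0, j + 1 => Hom.const (F.pt (F.iter j))
  -- Contravariance swaps the indices, so the two directions are defined together, by recursion on
  -- their sum.
  | k + 1, j + 1 => F.map (trans j k)
termination_by k j => k + j

theorem trans_zero_succ (j : ℕ) : F.trans 0 (j + 1) = Hom.const (F.pt (F.iter j)) := by
  rw [trans.eq_def]
  rfl

theorem trans_succ (k j : ℕ) : F.trans (k + 1) (j + 1) = F.map (F.trans j k) := by
  rw [trans.eq_def]

theorem trans_zero_succ_apply (j : ℕ) (x : F.iter 0) :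
    F.trans 0 (j + 1) x = F.pt (F.iter j) :=
  congrArg (fun f : (F.iter 0).Hom (F.iter (j + 1)) => f x) (F.trans_zero_succ j)

theorem trans_succ_apply (k j : ℕ) (x : F.iter (k + 1)) :
    F.trans (k + 1) (j + 1) x = F.map (F.trans j k) x :=
  congrArg (fun f : (F.iter (k + 1)).Hom (F.iter (j + 1)) => f x) (F.trans_succ k j)

theorem trans_succ_trans_succ (i j k : ℕ) (x : F.iter (i + 1)) :
    F.trans (j + 1) (k + 1) (F.trans (i + 1) (j + 1) x) =
      F.map ((F.trans j i).comp (F.trans k j)) x :=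
  (F.trans_succ_apply j k _).trans <|
    (congrArg (F.map (F.trans k j)) (F.trans_succ_apply i j x)).trans (F.map_comp _ _ x)

theorem iter_zero_eq (x y : F.iter 0) : x = y := rfl

/-- A detour through stage `j` loses nothing when `j` is at least one of the two end stages.
Stripping one application of the functor swaps `i` and `k`, and the condition on `min i k` is
symmetric under this swap. Starting from stage `0`, naturality of the point gives the claim. -/
theorem trans_trans (i j k : ℕ) (h : min i k ≤ j) :
    ∀ x, F.trans j k (F.trans i j x) = F.trans i k x := by
  induction j generalizing i k with
  | zero =>
    intro x
    rcases k with _ | k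
    · exact F.iter_zero_eq _ _
    · obtain rfl : i = 0 := by omega
      exact (F.trans_zero_succ_apply k _).trans (F.trans_zero_succ_apply k x).symm
  | succ j ih =>
    intro x
    rcases k with _ | k
    · exact F.iter_zero_eq _ _
    rcases i with _ | i
    · refine Eq.trans ?_ (F.trans_zero_succ_apply k x).symm
      refine (F.trans_succ_apply j k _).trans ?_
      exact (congrArg (F.map (F.trans k j)) (F.trans_zero_succ_apply j x)).trans (F.map_pt _)
    · refine (F.trans_succ_trans_succ i j k x).trans ?_
      exact (F.map_congr (ih k i (by omega)) x).trans (F.trans_succ_apply i k x).symm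

/-- Each application of the functor adds one level of agreement, starting from the total relation at
level `0`. -/
theorem eqn_trans_trans (j k : ℕ) : ∀ x, eqn j (F.trans j k (F.trans k j x)) x := by
  induction j generalizing k with
  | zero => exact fun x => eqn_zero _ _
  | succ j ih =>
    intro x
    rcases k with _ | k
    -- Stage `0` is the one-point object, where every level is total.
    · exact trivial
    · rw [trans_succ_trans_succ]
      exact F.eqn_map_self (ih k) x

/-- The underlying set of the inverse limit of the iterates. -/
def Lim : Type u := {x : ∀ k, F.iter k // ∀ j k, j ≤ k → F.trans k j (x k) = x j}

instance : COFE F.Lim where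
  eqn n x y := ∀ k, eqn n (x.1 k) (y.1 k)
  equivalence n :=
    ⟨fun _ _ => eqn_refl _ _, fun h k => eqn_symm (h k), fun h h' k => eqn_trans (h k) (h' k)⟩
  eqn_zero _ _ _ := eqn_zero _ _
  eqn_of_succ _ _ _ h k := eqn_of_succ _ _ _ (h k)
  eq_of_eqn x y h := Subtype.ext (funext fun k => eq_of_eqn _ _ fun n => h n k)
  complete a ha := by
    have hx : ∀ k, ∃ l, IsLimit (fun i => (a i).1 k) l := fun k =>
      COFE.complete _ fun n => by
        obtain ⟨N, hN⟩ := ha n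
        exact ⟨N, fun i hi j hj => hN i hi j hj k⟩
    choose l hl using hx
    refine ⟨⟨l, fun j k hjk => ?_⟩, fun n => ?_⟩
    · refine ((hl k).map (F.trans k j).nonExpansive).unique ?_
      have h : (fun i => F.trans k j ((a i).1 k)) = fun i => (a i).1 j :=
        funext fun i => (a i).2 j k hjk
      rw [h]
      exact hl j
    · obtain ⟨N, hN⟩ := ha n
      exact ⟨N, fun i hi k => (hl k).eqn_of_forall (fun m hm p hp => hN m hm p hp k) i hi⟩

theorem isLimit_val {a : ℕ → F.Lim} {l : F.Lim} (h : IsLimit a l) (k : ℕ) :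
    IsLimit (fun i => (a i).1 k) (l.1 k) := fun n => by
  obtain ⟨N, hN⟩ := h n
  exact ⟨N, fun i hi => hN i hi k⟩

/-- The inverse limit of the iterates, with the pointwise preorders. -/
def lim : BiPreCOFE.{u} where
  carrier := F.Lim
  gePriv x y := ∀ k, (F.iter k).gePriv (x.1 k) (y.1 k)
  gePub x y := ∀ k, (F.iter k).gePub (x.1 k) (y.1 k)
  isPriv :=
    { refl := fun _ k => (F.iter k).isPriv.refl _
      trans := fun _ _ _ h h' k => (F.iter k).isPriv.trans _ _ _ (h k) (h' k)
      limit := fun _ _ _ _ hl hm h k => (F.iter k).isPriv.limit _ _ _ _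
        (F.isLimit_val hl k) (F.isLimit_val hm k) fun n => h n k }
  isPub :=
    { refl := fun _ k => (F.iter k).isPub.refl _
      trans := fun _ _ _ h h' k => (F.iter k).isPub.trans _ _ _ (h k) (h' k)
      limit := fun _ _ _ _ hl hm h k => (F.iter k).isPub.limit _ _ _ _
        (F.isLimit_val hl k) (F.isLimit_val hm k) fun n => h n k }

/-- The projections from the inverse limit. -/
def proj (k : ℕ) : F.lim.Hom (F.iter k) where
  toFun x := x.1 k
  nonExpansive _ _ _ h := h k
  mono_priv _ _ h := h k
  mono_pub _ _ h := h k

/-- The embeddings of the iterates into the inverse limit. -/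
def embed (k : ℕ) : (F.iter k).Hom F.lim where
  toFun x := ⟨fun j => F.trans k j x, fun j m h => F.trans_trans k m j (by omega) x⟩
  nonExpansive n x y h j := (F.trans k j).nonExpansive n x y h
  mono_priv x y h j := (F.trans k j).mono_priv x y h
  mono_pub x y h j := (F.trans k j).mono_pub x y h

theorem trans_proj {j k : ℕ} (h : j ≤ k) (x : F.lim) : F.trans k j (F.proj k x) = F.proj j x :=
  x.2 j k h

theorem proj_embed (k j : ℕ) (x : F.iter k) : F.proj j (F.embed k x) = F.trans k j x := rfl

theorem embed_trans {j k : ℕ} (h : j ≤ k) (x : F.iter j) :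
    F.embed k (F.trans j k x) = F.embed j x :=
  Subtype.ext (funext fun m => F.trans_trans j k m (by omega) x)

/-- For `j ≤ k` this is exact compatibility of the family. Otherwise component `k` is itself the
image of component `j`, and the round trip through stage `k` is an identity up to level `k`. -/
theorem eqn_trans_proj (j k : ℕ) (x : F.lim) :
    eqn k (F.trans k j (F.proj k x)) (F.proj j x) := by
  rcases le_total j k with h | h
  · rw [F.trans_proj h]
    exact eqn_refl _ _
  · rw [← F.trans_proj h]
    exact F.eqn_trans_trans k j (F.proj j x)

theorem eqn_embed_proj (k : ℕ) (x : F.lim) : eqn k (F.embed k (F.proj k x)) x :=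
  fun j => F.eqn_trans_proj j k x

/-- The map from the functor applied to the inverse limit into the inverse limit. -/
def fold : (F.obj F.lim).Hom F.lim where
  toFun y := ⟨fun
      | 0 => PUnit.unit
      | k + 1 => F.map (F.embed k) y, fun
      | 0, _, _ => rfl
      | j + 1, 0, h => absurd h (Nat.not_succ_le_zero j)
      | j + 1, k + 1, h =>
        (F.trans_succ_apply k j _).trans ((F.map_comp _ _ y).trans
          (F.map_congr (fun x => F.embed_trans (Nat.le_of_succ_le_succ h) x) y))⟩
  nonExpansive n x y h
    | 0 => trivial
    | k + 1 => (F.map (F.embed k)).nonExpansive n x y h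
  mono_priv x y h
    | 0 => trivial
    | k + 1 => (F.map (F.embed k)).mono_priv x y h
  mono_pub x y h
    | 0 => trivial
    | k + 1 => (F.map (F.embed k)).mono_pub x y h

/-- The approximations of the inverse of `fold`. -/
def approx (k : ℕ) : F.lim.Hom (F.obj F.lim) := (F.map (F.proj k)).comp (F.proj (k + 1))

theorem eqn_approx {k m : ℕ} (h : k ≤ m) (x : F.lim) :
    eqn (k + 1) (F.approx k x) (F.approx m x) := by
  -- Both approximations are expressed through the same component `m + 1`, so that only the
  -- morphisms applied to it differ.
  have h1 : F.approx k x = F.map ((F.trans k m).comp (F.proj k)) (F.proj (m + 1) x) := by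
    refine Eq.trans ?_ (F.map_comp (F.proj k) (F.trans k m) _)
    refine congrArg (F.map (F.proj k)) ?_
    exact (F.trans_proj (Nat.succ_le_succ h) x).symm.trans (F.trans_succ_apply m k _)
  rw [h1]
  exact F.contractive k _ _ (fun a => F.eqn_trans_proj m k a) _

theorem exists_isLimit_approx (x : F.lim) : ∃ l, IsLimit (fun k => F.approx k x) l :=
  COFE.complete _ fun k => ⟨k, fun _ hm _ hn => eqn_of_succ _ _ _
    (eqn_trans (eqn_symm (F.eqn_approx hm x)) (F.eqn_approx hn x))⟩

/-- The inverse of `fold`, as a function. -/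
def unfoldFun (x : F.lim) : F.obj F.lim := (F.exists_isLimit_approx x).choose

theorem isLimit_unfoldFun (x : F.lim) : IsLimit (fun k => F.approx k x) (F.unfoldFun x) :=
  (F.exists_isLimit_approx x).choose_spec

/-- The inverse of `fold`. -/
def unfold : F.lim.Hom (F.obj F.lim) where
  toFun := F.unfoldFun
  nonExpansive n x y h := by
    obtain ⟨N, hN⟩ := F.isLimit_unfoldFun x n
    obtain ⟨M, hM⟩ := F.isLimit_unfoldFun y n
    exact eqn_trans (eqn_symm (hN (max N M) (le_max_left _ _))) (eqn_trans
      ((F.approx _).nonExpansive n x y h) (hM _ (le_max_right _ _)))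
  mono_priv x y h := (F.obj F.lim).isPriv.limit _ _ _ _ (F.isLimit_unfoldFun x)
    (F.isLimit_unfoldFun y) fun k => (F.approx k).mono_priv x y h
  mono_pub x y h := (F.obj F.lim).isPub.limit _ _ _ _ (F.isLimit_unfoldFun x)
    (F.isLimit_unfoldFun y) fun k => (F.approx k).mono_pub x y h

/-- The approximations of `fold y` are images of `y` under `embed k` after `proj k`, a morphism
tending to the identity. -/
theorem unfold_fold (y : F.obj F.lim) : F.unfold (F.fold y) = y := by
  refine (F.isLimit_unfoldFun _).unique (isLimit_of_eqn_self fun k => eqn_of_succ _ _ _ ?_)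
  have h : F.approx k (F.fold y) = F.map ((F.embed k).comp (F.proj k)) y := F.map_comp _ _ y
  rw [h]
  exact F.eqn_map_self (F.eqn_embed_proj k) y

/-- In component `k + 1`, folding the `m`-th approximation of `x` already returns the component of
`x` as soon as `m ≥ k`, so the limit is that of an eventually constant sequence. -/
theorem fold_unfold (x : F.lim) : F.fold (F.unfold x) = x := by
  refine Subtype.ext (funext fun k => ?_)
  rcases k with _ | k
  · exact F.iter_zero_eq _ _
  refine ((F.isLimit_unfoldFun x).map (F.map (F.embed k)).nonExpansive).unique
    (isLimit_const_of_le k fun m hm => ?_)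
  have h : F.map (F.embed k) (F.approx m x) = F.map (F.trans k m) (F.proj (m + 1) x) :=
    (F.map_comp _ _ _).trans (F.map_congr (fun a => F.proj_embed k m a) _)
  exact h.trans ((F.trans_succ_apply m k _).symm.trans (F.trans_proj (Nat.succ_le_succ hm) x))

end ContraFunctor

end BiPreCOFE

end CapWorlds

end

noncomputable section

namespace CapWorlds

open OFE

/-! ## The functor of region maps -/

/-! ### Actions on monotone predicates and on finite maps. -/

section Precompose

variable {X : Type u} {Y : Type v} [OFE X] [OFE Y]

/-- Precomposition with a monotone non-expansive map. -/
def MonNE.precomp {geX : X → X → Prop} {geY : Y → Y → Prop} {A : Type*} (f : X → Y)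
    (hf : NonExpansive f) (hmono : ∀ x' x, geX x' x → geY (f x') (f x)) (H : MonNE Y geY A) :
    MonNE X geX A where
  toFun x := H.toFun (f x)
  monotone x' x h := H.monotone _ _ (hmono x' x h)
  nonExpansive n x y h := H.nonExpansive _ _ _ (hf n x y h)

/-- Apply a function to all values of a finite map. -/
def finmapMap {X : Type u} {Y : Type v} (f : X → Y) (W : Finmap fun _ : ℕ => X) :
    Finmap fun _ : ℕ => Y :=
  Finmap.keysLookupEquiv.symm ⟨(W.keys, fun r => (W.lookup r).map f), fun r => by
    rw [Option.isSome_map, Finmap.lookup_isSome, Finmap.mem_keys]⟩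

theorem keys_finmapMap {X : Type u} {Y : Type v} (f : X → Y) (W : Finmap fun _ : ℕ => X) :
    (finmapMap f W).keys = W.keys :=
  Finmap.keysLookupEquiv_symm_apply_keys _

theorem lookup_finmapMap {X : Type u} {Y : Type v} (f : X → Y) (W : Finmap fun _ : ℕ => X)
    (r : ℕ) : (finmapMap f W).lookup r = (W.lookup r).map f :=
  Finmap.keysLookupEquiv_symm_apply_lookup _ r

theorem lookup_finmapMap_eq_some {X : Type u} {Y : Type v} {f : X → Y}
    {W : Finmap fun _ : ℕ => X} {r : ℕ} {y : Y} :
    (finmapMap f W).lookup r = some y ↔ ∃ x, W.lookup r = some x ∧ f x = y := by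
  rw [lookup_finmapMap, Option.map_eq_some_iff]

theorem nonExpansive_finmapMap {f : X → Y} (hf : NonExpansive f) :
    NonExpansive (finmapMap f) := fun n W V h => h.imp id fun h =>
  ⟨by rw [keys_finmapMap, keys_finmapMap, h.1], fun r x y hx hy => by
    obtain ⟨x', hx', rfl⟩ := lookup_finmapMap_eq_some.1 hx
    obtain ⟨y', hy', rfl⟩ := lookup_finmapMap_eq_some.1 hy
    exact hf _ _ _ (h.2 r x' y' hx' hy')⟩

theorem eqn_finmapMap {X : Type u} {f g : X → Y} {n : ℕ} (h : ∀ x, eqn n (f x) (g x))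
    (W : Finmap fun _ : ℕ => X) : eqn n (finmapMap f W) (finmapMap g W) := by
  refine Or.inr ⟨by rw [keys_finmapMap, keys_finmapMap], fun r x y hx hy => ?_⟩
  obtain ⟨x', hx', rfl⟩ := lookup_finmapMap_eq_some.1 hx
  obtain ⟨y', hy', rfl⟩ := lookup_finmapMap_eq_some.1 hy
  rw [hx'] at hy'
  cases hy'
  exact h x'

theorem finmapMap_mono {X : Type u} {Y : Type v} {geX : X → X → Prop} {geY : Y → Y → Prop}
    {f : X → Y} (hf : ∀ x' x, geX x' x → geY (f x') (f x)) {W' W : Finmap fun _ : ℕ => X}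
    (h : W.keys ⊆ W'.keys ∧
      ∀ r x' x, W'.lookup r = some x' → W.lookup r = some x → geX x' x) :
    (finmapMap f W).keys ⊆ (finmapMap f W').keys ∧ ∀ r y' y,
      (finmapMap f W').lookup r = some y' → (finmapMap f W).lookup r = some y → geY y' y := by
  rw [keys_finmapMap, keys_finmapMap]
  refine ⟨h.1, fun r y' y hy' hy => ?_⟩
  obtain ⟨x', hx', rfl⟩ := lookup_finmapMap_eq_some.1 hy'
  obtain ⟨x, hx, rfl⟩ := lookup_finmapMap_eq_some.1 hy
  exact hf _ _ (h.2 r x' x hx' hx)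

end Precompose

/-! ### Preorder laws and limit closure for future regions. -/

section RegionOrder

variable {State X : Type u} [OFE X] {gePriv gePub : X → X → Prop}

namespace Region

theorem PrivFuture.refl (ρ : Region State X gePriv gePub) : PrivFuture ρ ρ := by
  cases ρ with
  | revoked => exact .of_revoked _
  | temp s φ H => exact .of_temp _ _ _ _
  | perm s φ H => exact .perm_step _ _ _ _ (φ.priv_refl s)

theorem PrivFuture.trans (ρ₁ ρ₂ ρ₃ : Region State X gePriv gePub) (h : PrivFuture ρ₁ ρ₂)
    (h' : PrivFuture ρ₂ ρ₃) : PrivFuture ρ₁ ρ₃ := by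
  cases h' with
  | of_temp => exact .of_temp _ _ _ _
  | of_revoked => exact .of_revoked _
  | temp_step => exact .of_temp _ _ _ _
  | perm_step s s' φ H hs =>
    cases h with
    | perm_step _ s'' _ _ hs' => exact .perm_step _ _ _ _ (φ.priv_trans _ _ _ hs hs')

theorem PubFuture.refl (ρ : Region State X gePriv gePub) : PubFuture ρ ρ := by
  cases ρ with
  | revoked => exact .revoked_revoked
  | temp s φ H => exact .temp_step _ _ _ _ (φ.pub_refl s)
  | perm s φ H => exact .perm_step _ _ _ _ (φ.pub_refl s)

theorem PubFuture.trans (ρ₁ ρ₂ ρ₃ : Region State X gePriv gePub) (h : PubFuture ρ₁ ρ₂)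
    (h' : PubFuture ρ₂ ρ₃) : PubFuture ρ₁ ρ₃ := by
  cases h' with
  | revoked_revoked => exact h
  | temp_revoked s φ H =>
    cases h with
    | temp_step => exact .temp_revoked _ _ _
  | temp_step s s' φ H hs =>
    cases h with
    | temp_step _ s'' _ _ hs' => exact .temp_step _ _ _ _ (φ.pub_trans _ _ _ hs hs')
  | perm_step s s' φ H hs =>
    cases h with
    | perm_step _ s'' _ _ hs' => exact .perm_step _ _ _ _ (φ.pub_trans _ _ _ hs hs')

theorem exists_eqnPos_of_exists_eqn {P : Region State X gePriv gePub →
    Region State X gePriv gePub → Prop} {ρ' ρ : Region State X gePriv gePub}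
    (h : ∀ k, ∃ σ' σ, P σ' σ ∧ eqn k σ' ρ' ∧ eqn k σ ρ) (k : ℕ) :
    ∃ σ' σ, P σ' σ ∧ EqnPos (k + 1) σ' ρ' ∧ EqnPos (k + 1) σ ρ := by
  obtain ⟨σ', σ, hP, h1, h2⟩ := h (k + 1)
  exact ⟨σ', σ, hP, h1.resolve_left k.succ_ne_zero, h2.resolve_left k.succ_ne_zero⟩

theorem PrivFuture.of_approx (ρ' ρ : Region State X gePriv gePub)
    (h : ∀ k, ∃ σ' σ, PrivFuture σ' σ ∧ eqn k σ' ρ' ∧ eqn k σ ρ) : PrivFuture ρ' ρ := by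
  -- Shifting to positive levels makes even the first approximation determine summand, state and
  -- transition relations.
  replace h := exists_eqnPos_of_exists_eqn h
  cases ρ with
  | revoked => exact .of_revoked _
  | temp s φ H => exact .of_temp _ _ _ _
  | perm s φ H =>
    obtain ⟨σ', σ, hP, h1, h2⟩ := h 0
    cases h2
    cases hP with | perm_step _ s' _ _ hs => ?_
    cases h1 with | perm _ _ _ H' _ => ?_
    -- At each level the two approximating regions share one function, which is close to both `H'`
    -- and `H`.
    obtain rfl : H' = H := by
      refine funext fun t => eq_of_eqn _ _ fun k => ?_
      obtain ⟨σ', σ, hP, h1, h2⟩ := h k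
      cases h2 with | perm _ _ _ _ h2 => ?_
      cases hP
      cases h1 with | perm _ _ _ _ h1 => ?_
      exact eqn_of_succ _ _ _ (eqn_trans (eqn_symm (h1 t)) (h2 t))
    exact .perm_step _ _ _ _ hs

theorem PubFuture.of_approx (ρ' ρ : Region State X gePriv gePub)
    (h : ∀ k, ∃ σ' σ, PubFuture σ' σ ∧ eqn k σ' ρ' ∧ eqn k σ ρ) : PubFuture ρ' ρ := by
  replace h := exists_eqnPos_of_exists_eqn h
  -- Nothing is publicly reachable for free, so the first approximation is needed in every case to
  -- fix the shapes of both regions.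
  obtain ⟨σ', σ, hP, h1, h2⟩ := h 0
  cases h2 with
  | revoked =>
    cases hP with
    | revoked_revoked =>
      cases h1
      exact .revoked_revoked
    | temp_revoked =>
      cases h1
      exact .temp_revoked _ _ _
  | temp s φ _ H _ =>
    cases hP with | temp_step _ s' _ _ hs => ?_
    cases h1 with | temp _ _ _ H' _ => ?_
    obtain rfl : H' = H := by
      refine funext fun t => eq_of_eqn _ _ fun k => ?_
      obtain ⟨σ', σ, hP, h1, h2⟩ := h k
      cases h2 with | temp _ _ _ _ h2 => ?_
      cases hP
      cases h1 with | temp _ _ _ _ h1 => ?_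
      exact eqn_of_succ _ _ _ (eqn_trans (eqn_symm (h1 t)) (h2 t))
    exact .temp_step _ _ _ _ hs
  | perm s φ _ H _ =>
    cases hP with | perm_step _ s' _ _ hs => ?_
    cases h1 with | perm _ _ _ H' _ => ?_
    obtain rfl : H' = H := by
      refine funext fun t => eq_of_eqn _ _ fun k => ?_
      obtain ⟨σ', σ, hP, h1, h2⟩ := h k
      cases h2 with | perm _ _ _ _ h2 => ?_
      cases hP
      cases h1 with | perm _ _ _ _ h1 => ?_
      exact eqn_of_succ _ _ _ (eqn_trans (eqn_symm (h1 t)) (h2 t))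
    exact .perm_step _ _ _ _ hs

end Region

end RegionOrder

/-! ### Regions and worlds as a contravariant functor. -/

namespace BiPreCOFE

variable (State : Type u)

/-- Regions over a c.o.f.e. with two preorders. -/
abbrev Reg (A : BiPreCOFE.{u}) : Type u := Region State A A.gePriv A.gePub

variable {State} {A B C : BiPreCOFE.{u}}

/-- The contravariant action on regions. -/
def regMap (f : A.Hom B) : Reg State B → Reg State A
  | .revoked => .revoked
  | .temp s φ H => .temp s φ fun t => (H t).precomp f f.nonExpansive f.mono_pub
  | .perm s φ H => .perm s φ fun t => (H t).precomp f f.nonExpansive f.mono_priv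

theorem nonExpansive_regMap (f : A.Hom B) : NonExpansive (regMap (State := State) f) :=
  fun n ρ ρ' h => h.imp id fun h => by
    cases h with
    | revoked => exact .revoked
    | temp s φ H H' hH => exact .temp _ _ _ _ fun t x => hH t (f x)
    | perm s φ H H' hH => exact .perm _ _ _ _ fun t x => hH t (f x)

theorem regMap_priv (f : A.Hom B) (ρ' ρ : Reg State B) (h : Region.PrivFuture ρ' ρ) :
    Region.PrivFuture (regMap f ρ') (regMap f ρ) := by
  cases h with
  -- Every region is a private future of a temporary one, so the transition need not be tracked.
  | temp_step => exact .of_temp _ _ _ _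
  | perm_step s s' φ H h => exact .perm_step _ _ _ _ h
  | of_temp => exact .of_temp _ _ _ _
  | of_revoked => exact .of_revoked _

theorem regMap_pub (f : A.Hom B) (ρ' ρ : Reg State B) (h : Region.PubFuture ρ' ρ) :
    Region.PubFuture (regMap f ρ') (regMap f ρ) := by
  cases h with
  | temp_step s s' φ H h => exact .temp_step _ _ _ _ h
  | perm_step s s' φ H h => exact .perm_step _ _ _ _ h
  | temp_revoked => exact .temp_revoked _ _ _
  | revoked_revoked => exact .revoked_revoked

theorem regMap_regMap (f : A.Hom B) (g : B.Hom C) (ρ : Reg State C) :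
    regMap f (regMap g ρ) = regMap (g.comp f) ρ := by
  cases ρ <;> rfl

theorem regMap_id (f : A.Hom A) (h : ∀ a, f a = a) (ρ : Reg State A) : regMap f ρ = ρ := by
  cases ρ with
  | revoked => rfl
  | temp s φ H =>
    exact congrArg (Region.temp s φ) (funext fun t => MonNE.ext (funext fun x =>
      congrArg (H t).toFun (h x)))
  | perm s φ H =>
    exact congrArg (Region.perm s φ) (funext fun t => MonNE.ext (funext fun x =>
      congrArg (H t).toFun (h x)))

/-- The stored predicates are non-expansive, so closeness of `f` and `g` carries over at the same
level; no level is gained here. -/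
theorem eqn_regMap {n : ℕ} {f g : A.Hom B} (h : ∀ a, eqn n (f a) (g a)) (ρ : Reg State B) :
    eqn n (regMap f ρ) (regMap g ρ) := by
  refine Or.inr ?_
  cases ρ with
  | revoked => exact .revoked
  | temp s φ H => exact .temp _ _ _ _ fun t x => (H t).nonExpansive _ _ _ (h x)
  | perm s φ H => exact .perm _ _ _ _ fun t x => (H t).nonExpansive _ _ _ (h x)

variable (State)

/-- Region maps, guarded by `▶`, with the private and public future world relations. -/
def worlds (A : BiPreCOFE.{u}) : BiPreCOFE.{u} where
  carrier := Later (RegionMap State A A.gePriv A.gePub)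
  gePriv W' W := RegionMap.PrivFuture W'.val W.val
  gePub W' W := RegionMap.PubFuture W'.val W.val
  isPriv := isPreorderedCOFE_later_finmap Region.PrivFuture.refl Region.PrivFuture.trans
    Region.PrivFuture.of_approx
  isPub := isPreorderedCOFE_later_finmap Region.PubFuture.refl Region.PubFuture.trans
    Region.PubFuture.of_approx

/-- The functor of region maps. -/
def worldsFunctor : ContraFunctor.{u} where
  obj := worlds State
  map {A B} f :=
    { toFun := fun W => ⟨finmapMap (regMap f) W.val⟩
      nonExpansive := fun
        | 0, _, _, _ => trivial
        | n + 1, W, V, h => nonExpansive_finmapMap (nonExpansive_regMap f) n W.val V.val h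
      mono_priv := fun _ _ h => finmapMap_mono (regMap_priv f) h
      mono_pub := fun _ _ h => finmapMap_mono (regMap_pub f) h }
  pt _ := ⟨∅⟩
  map_pt f := Later.ext (Finmap.ext_lookup fun r => lookup_finmapMap _ _ r)
  map_comp f g W := Later.ext (Finmap.ext_lookup fun r => by
    simp only [lookup_finmapMap, Option.map_map]
    exact congrArg (fun F => Option.map F _) (funext fun ρ => regMap_regMap f g ρ))
  map_id f h W := Later.ext (Finmap.ext_lookup fun r => by
    rw [lookup_finmapMap, funext (regMap_id f h)]
    exact congrFun Option.map_id _)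
  -- Level `n + 1` under `▶` unfolds to level `n` on finite maps, which is the only source of
  -- contractiveness.
  contractive n f g h W := eqn_finmapMap (fun ρ => eqn_regMap h ρ) W.val

end BiPreCOFE

end CapWorlds

end

theorem mainTheorem2 (State : Type u) :
    ∃ (Wor : Type u) (_ : COFE Wor) (gePriv gePub : Wor → Wor → Prop),
      IsPreorderedCOFE Wor gePriv ∧ IsPreorderedCOFE Wor gePub ∧
      ∃ ξ : COFEIso Wor (Later (RegionMap State Wor gePriv gePub)),
        (∀ W' W : Wor, gePriv W' W ↔
          RegionMap.PrivFuture (ξ.toEquiv W').val (ξ.toEquiv W).val) ∧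
        (∀ W' W : Wor, gePub W' W ↔
          RegionMap.PubFuture (ξ.toEquiv W').val (ξ.toEquiv W).val) := by
  let F := BiPreCOFE.worldsFunctor State
  refine ⟨F.lim, inferInstance, F.lim.gePriv, F.lim.gePub, F.lim.isPriv, F.lim.isPub,
    { toFun := F.unfold
      invFun := F.fold
      left_inv := F.fold_unfold
      right_inv := F.unfold_fold
      nonExpansive_toFun := F.unfold.nonExpansive
      nonExpansive_invFun := F.fold.nonExpansive },
    fun W' W => ⟨F.unfold.mono_priv W' W, fun h => ?_⟩,
    fun W' W => ⟨F.unfold.mono_pub W' W, fun h => ?_⟩⟩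
  -- Reflection of the preorder is monotonicity of the inverse.
  · rw [← F.fold_unfold W', ← F.fold_unfold W]
    exact F.fold.mono_priv _ _ h
  · rw [← F.fold_unfold W', ← F.fold_unfold W]
    exact F.fold.mono_pub _ _ h
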